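/- Let $n\in\mathbb N$ and $T>0$. Equip $\mathbb R^n$ with the norm $\|x\|=\sum_j|x_j|$ and $\mathcal L(\mathbb R^n)$ with the induced operator norm, and let $G[0,T]$ be the Banach space of regulated functions $[0,T]\to\mathbb R^n$ (all one-sided limits exist) with the supremum norm. Integrals $\int_a^b DU(\tau,t)$ are Kurzweil integrals, i.e. limits, with respect to gauges, of the sums $\sum_j[U(\tau_j,t_j)-U(\tau_j,t_{j-1})]$ over tagged partitions. For a Banach space $Y$, an open set $\Omega\subset\mathbb R^n$, a nondecreasing $h:[0,T]\to\mathbb R$ and an increasing continuous $\omega:[0,\infty)\to[0,\infty)$ with $\omega(0)=0$, let $\mathcal F(\Omega\times[0,T],h,\omega;Y)$ be the set of all $F:\Omega\times[0,T]\to Y$ such that $$\|F(x,t_2)-F(x,t_1)\|\le|h(t_2)-h(t_1)|,\qquad \|F(x,t_2)-F(x,t_1)-F(y,t_2)+F(y,t_1)\|\le\omega(\|x-y\|)\,|h(t_2)-h(t_1)|$$ for all $x,y\in\Omega$ and $t_1,t_2\in[0,T]$. Let $\Omega\subset\mathbb R^n$ and $\Lambda\subset\mathbb R$ be open and let $F:\Lambda\times\Omega\times[0,T]\to\mathbb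 R^n$, $x_0\in G[0,T]$ and $\lambda_0\in\Lambda$. Assume: 1. there are $h,\omega$ as above, independent of $\lambda$, with $F(\lambda,\cdot,\cdot)\in\mathcal F(\Omega\times[0,T],h,\omega;\mathbb R^n)$ for all $\lambda\in\Lambda$; 2. for every $\lambda\in\Lambda$ the function $x_0$ is a solution of the periodic problem $\frac{dx}{d\tau}=DF(\lambda,x,t)$, $x(0)=x(T)$; that is, $x_0(s)\in\Omega$ and $x_0(s)=x_0(0)+\int_0^sDF(\lambda,x_0(\tau),t)$ for all $s\in[0,T]$, and $x_0(0)=x_0(T)$; 3. there is $\rho>0$ such that $x(t)\in\Omega$ for all $t\in[0,T]$ and all $x\in G[0,T]$ with $\|x-x_0\|_\infty\le\rho$; 4. for all $(\lambda,x,t)\in\Lambda\times\Omega\times[0,T]$ the Fréchet derivative $F'_x(\lambda,x,t)\in\mathcal L(\mathbb R^n)$ of $F(\lambda,\cdot,t)$ at $x$ exists, for fixed $(\lambda,t)$ it is continuous in $x\in\Omega$, and there are $\widetilde h,\widetilde\omega$ as above, independent of $\lambda$, with $F'_x(\lambda,\cdot,\cdot)\in\mathcal F(\Omega\times[0,T],\widetilde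 h,\widetilde\omega;\mathcal L(\mathbb R^n))$ for all $\lambda\in\Lambda$. Then exactly one of the following holds: (i) for every $q\in G[0,T]$ the equation $$z(s)-z(T)-\int_0^sD[F'_x(\lambda_0,x_0(\tau),t)\,z(\tau)]=q(s)\quad\text{for } s\in[0,T]$$ has a unique solution $z\in G[0,T]$; (ii) the homogeneous equation $$z(s)-z(T)-\int_0^sD[F'_x(\lambda_0,x_0(\tau),t)\,z(\tau)]=0\quad\text{for } s\in[0,T]$$ has a nontrivial solution $z\in G[0,T]$. Moreover, all these integrals exist for every $z\in G[0,T]$ and $s\in[0,T]$, and $z\mapsto\big(s\mapsto z(T)+\int_0^sD[F'_x(\lambda_0,x_0(\tau),t)\,z(\tau)]\big)$ defines a compact bounded linear operator on $G[0,T]$. -/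

import Mathlib

open Set Filter Topology
open scoped ENNReal

noncomputable section

/-- The space of real `n`-vectors with the norm `‖x‖ = ∑ j, |x j|`. -/
abbrev RVec (n : ℕ) : Type := PiLp 1 (fun _ : Fin n => ℝ)

/-- A function on `[a, b]` is regulated if all its one-sided limits exist. The filters are taken
inside `[a, b]`, so the left condition at `a` and the right condition at `b` are void. -/
def IsRegulated {a b : ℝ} {X : Type*} [TopologicalSpace X] (x : Icc a b → X) : Prop :=
  ∀ t : Icc a b, (∃ l : X, Tendsto x (𝓝[<] t) (𝓝 l)) ∧ (∃ r : X, Tendsto x (𝓝[>] t) (𝓝 r))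

section RegulatedSpace

variable {a b : ℝ} {X : Type*} [NormedAddCommGroup X]

theorem IsRegulated.exists_bound {x : Icc a b → X} (hx : IsRegulated x) :
    ∃ C : ℝ, ∀ t, ‖x t‖ ≤ C := by
  have key : ∃ C : ℝ, ∀ t ∈ (Set.univ : Set (Icc a b)), ‖x t‖ ≤ C := by
    refine isCompact_univ.induction_on (p := fun s => ∃ C : ℝ, ∀ t ∈ s, ‖x t‖ ≤ C)
      ⟨0, by simp⟩ ?_ ?_ ?_
    · rintro s t hst ⟨C, hC⟩
      exact ⟨C, fun u hu => hC u (hst hu)⟩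
    · rintro s t ⟨C, hC⟩ ⟨D, hD⟩
      refine ⟨max C D, fun u hu => ?_⟩
      rcases hu with hu | hu
      · exact (hC u hu).trans (le_max_left _ _)
      · exact (hD u hu).trans (le_max_right _ _)
    · intro t _
      obtain ⟨⟨l, hl⟩, ⟨r, hr⟩⟩ := hx t
      have e1 : ∀ᶠ u in 𝓝[<] t, ‖x u‖ ≤ ‖l‖ + 1 :=
        (hl.norm.eventually (gt_mem_nhds (lt_add_one ‖l‖))).mono fun _ h => h.le
      have e2 : ∀ᶠ u in 𝓝[>] t, ‖x u‖ ≤ ‖r‖ + 1 :=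
        (hr.norm.eventually (gt_mem_nhds (lt_add_one ‖r‖))).mono fun _ h => h.le
      rw [eventually_nhdsWithin_iff] at e1 e2
      refine ⟨{u | ‖x u‖ ≤ max (max (‖l‖ + 1) (‖r‖ + 1)) ‖x t‖}, ?_, _, fun u hu => hu⟩
      rw [nhdsWithin_univ]
      filter_upwards [e1, e2] with u h1 h2
      rcases lt_trichotomy u t with h | h | h
      · exact (h1 h).trans ((le_max_left _ _).trans (le_max_left _ _))
      · exact h ▸ le_max_right _ _
      · exact (h2 h).trans ((le_max_right _ _).trans (le_max_left _ _))
  exact key.imp fun C hC t => hC t (mem_univ t)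

theorem IsRegulated.memℓp {x : Icc a b → X} (hx : IsRegulated x) :
    Memℓp (E := fun _ : Icc a b => X) x ∞ := by
  obtain ⟨C, hC⟩ := hx.exists_bound
  refine memℓp_infty ⟨C, ?_⟩
  rintro _ ⟨t, rfl⟩
  exact hC t

variable (a b X) [NormedSpace ℝ X]

/-- The regulated functions as a subspace of the space of all bounded functions `[a, b] → X` with
the supremum norm. -/
def regulatedSubmodule : Submodule ℝ (lp (fun _ : Icc a b => X) ∞) where
  carrier := {x | IsRegulated (fun t => x t)}
  zero_mem' := fun _ => ⟨⟨0, tendsto_const_nhds⟩, ⟨0, tendsto_const_nhds⟩⟩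
  add_mem' := by
    intro x y hx hy t
    obtain ⟨⟨l, hl⟩, ⟨r, hr⟩⟩ := hx t
    obtain ⟨⟨l', hl'⟩, ⟨r', hr'⟩⟩ := hy t
    exact ⟨⟨l + l', hl.add hl'⟩, ⟨r + r', hr.add hr'⟩⟩
  smul_mem' := by
    intro c x hx t
    obtain ⟨⟨l, hl⟩, ⟨r, hr⟩⟩ := hx t
    exact ⟨⟨c • l, hl.const_smul c⟩, ⟨c • r, hr.const_smul c⟩⟩

/-- The space `G([a, b]; X)` of regulated functions `[a, b] → X` with the supremum norm. -/
abbrev RegulatedSpace : Type _ := regulatedSubmodule a b X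

variable {a b X}

/-- Every regulated function is an element of `G([a, b]; X)`. -/
def RegulatedSpace.mk (x : Icc a b → X) (hx : IsRegulated x) : RegulatedSpace a b X :=
  ⟨⟨x, hx.memℓp⟩, hx⟩

/-- The value `x(t)`, for `t ∈ [a, b]`, of a regulated function `x` (zero for other `t`). -/
def RegulatedSpace.eval (x : RegulatedSpace a b X) (t : ℝ) : X :=
  open Classical in if h : t ∈ Icc a b then (x : lp (fun _ : Icc a b => X) ∞) ⟨t, h⟩ else 0

end RegulatedSpace

/-- A tagged partition of `[a, b]`: division points `a = t 0 ≤ t 1 ≤ ⋯ ≤ t ν = b` and tags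
`τ j ∈ [t j, t (j + 1)]` for `j < ν`. -/
structure TaggedPartition (a b : ℝ) where
  ν : ℕ
  t : ℕ → ℝ
  τ : ℕ → ℝ
  t_zero : t 0 = a
  t_last : t ν = b
  tag_mem : ∀ j < ν, t j ≤ τ j ∧ τ j ≤ t (j + 1)

/-- Fineness of a tagged partition with respect to a gauge `δ`. -/
def TaggedPartition.IsFine {a b : ℝ} (P : TaggedPartition a b) (δ : ℝ → ℝ) : Prop :=
  ∀ j < P.ν, Icc (P.t j) (P.t (j + 1)) ⊆ Ioo (P.τ j - δ (P.τ j)) (P.τ j + δ (P.τ j))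

/-- The integral sum of `U` with respect to a tagged partition. -/
def TaggedPartition.sum {a b : ℝ} {X : Type*} [AddCommGroup X] (P : TaggedPartition a b)
    (U : ℝ → ℝ → X) : X :=
  ∑ j ∈ Finset.range P.ν, (U (P.τ j) (P.t (j + 1)) - U (P.τ j) (P.t j))

/-- For `a ≤ b`: the Kurzweil integral `∫_a^b DU(τ, t)` exists and equals `I`. Only the values of
`U` on `[a, b] × [a, b]` matter, and for `a = b` the integral is `0`. -/
def HasKurzweilIntegral {X : Type*} [NormedAddCommGroup X] (U : ℝ → ℝ → X) (a b : ℝ) (I : X) :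
    Prop :=
  ∀ ε > 0, ∃ δ : ℝ → ℝ, (∀ τ, 0 < δ τ) ∧
    ∀ P : TaggedPartition a b, P.IsFine δ → ‖P.sum U - I‖ < ε

/-- The class `𝓕(Ω × [a, b], h, ω; Y)` of functions `F : Ω × [a, b] → Y`, including the
requirements on `h` and `ω`. -/
structure KurzweilClass {X Y : Type*} [NormedAddCommGroup X] [NormedAddCommGroup Y]
    (Ω : Set X) (a b : ℝ) (h ω : ℝ → ℝ) (F : X → ℝ → Y) : Prop where
  h_mono : MonotoneOn h (Icc a b)
  ω_strictMono : StrictMonoOn ω (Ici 0)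
  ω_cont : ContinuousOn ω (Ici 0)
  ω_zero : ω 0 = 0
  bound : ∀ x ∈ Ω, ∀ t₁ ∈ Icc a b, ∀ t₂ ∈ Icc a b, ‖F x t₂ - F x t₁‖ ≤ |h t₂ - h t₁|
  bound_diff : ∀ x ∈ Ω, ∀ y ∈ Ω, ∀ t₁ ∈ Icc a b, ∀ t₂ ∈ Icc a b,
    ‖F x t₂ - F x t₁ - F y t₂ + F y t₁‖ ≤ ω ‖x - y‖ * |h t₂ - h t₁|

/-- `x` is a solution on `[0, T]` of the periodic problem `dx/dτ = DF(x, t)`, `x(0) = x(T)`. -/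
def IsPeriodicSolution {n : ℕ} {T : ℝ} (Ω : Set (RVec n)) (F : RVec n → ℝ → RVec n)
    (x : RegulatedSpace 0 T (RVec n)) : Prop :=
  (∀ s ∈ Icc 0 T, x.eval s ∈ Ω ∧
    HasKurzweilIntegral (fun τ t => F (x.eval τ) t) 0 s (x.eval s - x.eval 0)) ∧
  x.eval 0 = x.eval T

/-- `z` is a solution of `z(s) - z(T) - ∫_0^s D[A(x(τ), t) z(τ)] = q(s)` for `s ∈ [0, T]`,
where the existence of the integral is part of the assertion. -/
def SolvesLinearized {n : ℕ} {T : ℝ} (A : RVec n → ℝ → (RVec n →L[ℝ] RVec n))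
    (x z q : RegulatedSpace 0 T (RVec n)) : Prop :=
  ∀ s ∈ Icc 0 T, ∃ J : RVec n,
    HasKurzweilIntegral (fun τ t => A (x.eval τ) t (z.eval τ)) 0 s J ∧
    z.eval s - z.eval T - J = q.eval s

end

/-! With `A τ t = F' lam₀ (x₀.eval τ) t` and `(K z)(s) = z(T) + ∫_0^s D[A(τ,t) z(τ)]`, the
linearized equation is `z - K z = q`. If `K` is a compact operator on the Banach space of regulated
functions, then `1` is an eigenvalue of `K` or lies in its resolvent set, and these are the two
alternatives. What remains is that the integrals exist and that `K` is compact.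

Existence (`exists_hasKurzweilIntegral`): the increments of `A τ` are dominated by those of a
monotone `h`, and they depend on `τ` through `x₀(τ)` with a modulus of continuity. The pair `(x₀,
z)` is nearly constant on the classes of a finite partition of the interval into intervals
(`IsRegulated.exists_finite_partition`). Freezing `τ` at one representative per class therefore
changes every integral sum by little. The frozen integrand is a finite sum of differences of
functions `f(t)` cut off to lower sets of `τ`. Sums of such a cut-off telescope, and a suitable
gauge makes them converge to a one-sided limit or an endpoint value of `f` minus `f(a)`
(`exists_hasKurzweilIntegral_lowerSet`). A Cauchy argument passes to the original integrand.

Compactness (`exists_isCompactOperator_kurzweil`): the increments of `K z` are at most `‖z‖` times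
those of `h`. So `K` maps the unit ball to a bounded set of functions controlled by one monotone
function, and sampling them once on each level band of `h` shows total boundedness
(`RegulatedSpace.totallyBounded_of_dominated`). -/

namespace TaggedPartition

/-! ### Tagged partitions, gauges and integral sums -/

variable {a b c : ℝ}

theorem t_le_succ (P : TaggedPartition a b) {j : ℕ} (hj : j < P.ν) : P.t j ≤ P.t (j + 1) :=
  (P.tag_mem j hj).1.trans (P.tag_mem j hj).2

theorem t_mono (P : TaggedPartition a b) {i j : ℕ} (hij : i ≤ j) (hj : j ≤ P.ν) :
    P.t i ≤ P.t j := by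
  induction j, hij using Nat.le_induction with
  | base => exact le_rfl
  | succ j _ ih => exact (ih (by omega)).trans (P.t_le_succ (by omega))

theorem t_mem (P : TaggedPartition a b) {j : ℕ} (hj : j ≤ P.ν) : P.t j ∈ Icc a b :=
  ⟨P.t_zero.symm.le.trans (P.t_mono (Nat.zero_le j) hj), (P.t_mono hj le_rfl).trans_eq P.t_last⟩

theorem le (P : TaggedPartition a b) : a ≤ b :=
  (P.t_mem le_rfl).1.trans_eq P.t_last

theorem τ_mem (P : TaggedPartition a b) {j : ℕ} (hj : j < P.ν) : P.τ j ∈ Icc a b :=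
  ⟨(P.t_mem hj.le).1.trans (P.tag_mem j hj).1,
    (P.tag_mem j hj).2.trans (P.t_mem (Nat.succ_le_of_lt hj)).2⟩

/-- A division point separates distinct tags. Hence the tags in a lower set form an initial segment.
-/
theorem τ_mono (P : TaggedPartition a b) {i j : ℕ} (hij : i ≤ j) (hj : j < P.ν) :
    P.τ i ≤ P.τ j := by
  rcases hij.eq_or_lt with rfl | h
  · exact le_rfl
  · exact (P.tag_mem i (h.trans hj)).2.trans
      ((P.t_mono (Nat.succ_le_of_lt h) hj.le).trans (P.tag_mem j hj).1)

/-- The tagged partition of `[a, a]` without intervals. -/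
def nil (a : ℝ) : TaggedPartition a a :=
  ⟨0, fun _ => a, fun _ => a, rfl, rfl, fun _ h => absurd h (Nat.not_lt_zero _)⟩

/-- The tagged partition with a single interval. -/
def single {s : ℝ} (has : a ≤ s) (hsb : s ≤ b) : TaggedPartition a b where
  ν := 1
  t j := if j = 0 then a else b
  τ _ := s
  t_zero := by simp
  t_last := by simp
  tag_mem j hj := by
    obtain rfl : j = 0 := by omega
    simpa using ⟨has, hsb⟩

/-- Concatenation of tagged partitions of adjacent intervals. -/
def append (P : TaggedPartition a b) (Q : TaggedPartition b c) : TaggedPartition a c where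
  ν := P.ν + Q.ν
  t j := if j ≤ P.ν then P.t j else Q.t (j - P.ν)
  τ j := if j < P.ν then P.τ j else Q.τ (j - P.ν)
  t_zero := by simp [P.t_zero]
  t_last := by
    by_cases h : Q.ν = 0
    · have := Q.t_last
      rw [h, Q.t_zero] at this
      simp [h, P.t_last, this]
    · rw [if_neg (by omega), Nat.add_sub_cancel_left, Q.t_last]
  tag_mem j hj := by
    rcases lt_trichotomy j P.ν with h | h | h
    · simpa [h, h.le, Nat.succ_le_of_lt h] using P.tag_mem j h
    · subst h
      simpa [P.t_last, Q.t_zero] using Q.tag_mem 0 (by omega)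
    · rw [if_neg (by omega), if_neg (by omega), if_neg (by omega), Nat.succ_sub h.le]
      exact Q.tag_mem (j - P.ν) (by omega)

theorem append_left (P : TaggedPartition a b) (Q : TaggedPartition b c) {j : ℕ} (hj : j < P.ν) :
    (P.append Q).t j = P.t j ∧ (P.append Q).t (j + 1) = P.t (j + 1) ∧
      (P.append Q).τ j = P.τ j := by
  simp [append, hj, hj.le, Nat.succ_le_of_lt hj]

theorem append_right (P : TaggedPartition a b) (Q : TaggedPartition b c) (j : ℕ) :
    (P.append Q).t (P.ν + j) = Q.t j ∧ (P.append Q).t (P.ν + j + 1) = Q.t (j + 1) ∧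
      (P.append Q).τ (P.ν + j) = Q.τ j := by
  refine ⟨?_, ?_, ?_⟩
  · rcases Nat.eq_zero_or_pos j with rfl | h
    · simp [append, P.t_last, Q.t_zero]
    · simp only [append]
      rw [if_neg (by omega), Nat.add_sub_cancel_left]
  · simp only [append]
    rw [if_neg (by omega), Nat.add_assoc, Nat.add_sub_cancel_left]
  · simp [append]

theorem IsFine.append {δ : ℝ → ℝ} {P : TaggedPartition a b} {Q : TaggedPartition b c}
    (hP : P.IsFine δ) (hQ : Q.IsFine δ) : (P.append Q).IsFine δ := by
  intro j hj
  rcases lt_or_ge j P.ν with h | h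
  · obtain ⟨h1, h2, h3⟩ := P.append_left Q h
    rw [h1, h2, h3]
    exact hP j h
  · obtain ⟨k, rfl⟩ := Nat.exists_eq_add_of_le h
    obtain ⟨h1, h2, h3⟩ := P.append_right Q k
    rw [h1, h2, h3]
    exact hQ k (by simp only [TaggedPartition.append] at hj; omega)

theorem sum_append {X : Type*} [AddCommGroup X] (P : TaggedPartition a b)
    (Q : TaggedPartition b c) (U : ℝ → ℝ → X) : (P.append Q).sum U = P.sum U + Q.sum U := by
  have hν : (P.append Q).ν = P.ν + Q.ν := rfl
  rw [sum, hν, Finset.sum_range_add]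
  congr 1
  · refine Finset.sum_congr rfl fun j hj => ?_
    obtain ⟨h1, h2, h3⟩ := P.append_left Q (Finset.mem_range.1 hj)
    rw [h1, h2, h3]
  · refine Finset.sum_congr rfl fun j _ => ?_
    obtain ⟨h1, h2, h3⟩ := P.append_right Q j
    rw [h1, h2, h3]

theorem isFine_single {δ : ℝ → ℝ} {s : ℝ} (has : a ≤ s) (hsb : s ≤ b) (h1 : s - δ s < a)
    (h2 : b < s + δ s) : (single has hsb).IsFine δ := by
  intro j hj
  obtain rfl : j = 0 := by simp only [single] at hj; omega
  intro u hu
  simp only [single, if_true, Nat.zero_add, one_ne_zero, if_false] at hu ⊢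
  exact ⟨h1.trans_le hu.1, hu.2.trans_lt h2⟩

/-- **Cousin's lemma**. -/
theorem exists_isFine {δ : ℝ → ℝ} (hδ : ∀ τ, 0 < δ τ) (hab : a ≤ b) :
    ∃ P : TaggedPartition a b, P.IsFine δ := by
  set S : Set ℝ := {c | c ∈ Icc a b ∧ ∃ P : TaggedPartition a c, P.IsFine δ} with hS
  have haS : a ∈ S := ⟨left_mem_Icc.2 hab, nil a, fun _ h => absurd h (Nat.not_lt_zero _)⟩
  have hbdd : BddAbove S := ⟨b, fun x hx => hx.1.2⟩
  set c := sSup S with hc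
  have hac : a ≤ c := le_csSup hbdd haS
  have hcb : c ≤ b := csSup_le ⟨a, haS⟩ fun x hx => hx.1.2
  obtain ⟨d, ⟨⟨had, hdb⟩, P, hP⟩, hd⟩ := exists_lt_of_lt_csSup ⟨a, haS⟩
    (show c - δ c < sSup S from by linarith [hδ c])
  have hdc : d ≤ c := le_csSup hbdd ⟨⟨had, hdb⟩, P, hP⟩
  -- One more interval `[d, e]`, tagged at `c`, reaches past the supremum.
  have key : ∀ e ∈ Icc c b, e < c + δ c → e ∈ S := fun e he hlt =>
    ⟨⟨hac.trans he.1, he.2⟩, P.append (single hdc he.1),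
      hP.append (isFine_single hdc he.1 hd hlt)⟩
  rcases hcb.eq_or_lt with h | h
  · have := key c ⟨le_rfl, hcb⟩ (by linarith [hδ c])
    rw [h] at this
    exact this.2
  · have hm : min b (c + δ c / 2) ∈ S := by
      refine key _ ⟨le_min hcb (by linarith [hδ c]), min_le_left _ _⟩ ?_
      exact (min_le_right _ _).trans_lt (by linarith [hδ c])
    have := le_csSup hbdd hm
    have : c < min b (c + δ c / 2) := lt_min h (by linarith [hδ c])
    linarith

/-- The filter of tagged partitions along which the Kurzweil integral is a limit. -/
def fineFilter (a b : ℝ) : Filter (TaggedPartition a b) :=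
  ⨅ δ : {δ : ℝ → ℝ // ∀ τ, 0 < δ τ}, 𝓟 {P | P.IsFine δ.1}

theorem IsFine.mono {δ δ' : ℝ → ℝ} (h : ∀ τ, δ τ ≤ δ' τ) {P : TaggedPartition a b}
    (hP : P.IsFine δ) : P.IsFine δ' := fun j hj =>
  (hP j hj).trans (Ioo_subset_Ioo (by linarith [h (P.τ j)]) (by linarith [h (P.τ j)]))

/-- The pointwise minimum of two gauges is a gauge, so the family is directed. -/
theorem hasBasis_fineFilter (a b : ℝ) : (fineFilter a b).HasBasis (fun _ => True)
    fun δ : {δ : ℝ → ℝ // ∀ τ, 0 < δ τ} => {P | P.IsFine δ.1} := by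
  have : Nonempty {δ : ℝ → ℝ // ∀ τ, 0 < δ τ} := ⟨⟨fun _ => 1, fun _ => one_pos⟩⟩
  refine hasBasis_iInf_principal ?_
  rintro ⟨δ, hδ⟩ ⟨δ', hδ'⟩
  exact ⟨⟨fun τ => min (δ τ) (δ' τ), fun τ => lt_min (hδ τ) (hδ' τ)⟩,
    fun P hP => IsFine.mono (fun τ => min_le_left _ _) hP,
    fun P hP => IsFine.mono (fun τ => min_le_right _ _) hP⟩

theorem fineFilter_neBot (hab : a ≤ b) : (fineFilter a b).NeBot :=
  (hasBasis_fineFilter a b).neBot_iff.2 fun {δ} _ => exists_isFine δ.2 hab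

theorem sum_add {X : Type*} [AddCommGroup X] (P : TaggedPartition a b) (U V : ℝ → ℝ → X) :
    P.sum (fun τ t => U τ t + V τ t) = P.sum U + P.sum V := by
  simp only [sum, ← Finset.sum_add_distrib]
  exact Finset.sum_congr rfl fun _ _ => by abel

theorem sum_smul {X : Type*} [AddCommGroup X] [Module ℝ X] (P : TaggedPartition a b) (c : ℝ)
    (U : ℝ → ℝ → X) : P.sum (fun τ t => c • U τ t) = c • P.sum U := by
  simp only [sum, Finset.smul_sum, smul_sub]

theorem sum_sub {X : Type*} [AddCommGroup X] (P : TaggedPartition a b) (U V : ℝ → ℝ → X) :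
    P.sum (fun τ t => U τ t - V τ t) = P.sum U - P.sum V := by
  simp only [sum, ← Finset.sum_sub_distrib]
  exact Finset.sum_congr rfl fun _ _ => by abel

theorem sum_finsetSum {X ι : Type*} [AddCommGroup X] (P : TaggedPartition a b) (s : Finset ι)
    (U : ι → ℝ → ℝ → X) :
    P.sum (fun τ t => ∑ i ∈ s, U i τ t) = ∑ i ∈ s, P.sum (U i) := by
  simp only [sum, ← Finset.sum_sub_distrib]
  exact Finset.sum_comm

theorem norm_sum_le {X : Type*} [NormedAddCommGroup X] (P : TaggedPartition a b)
    {U : ℝ → ℝ → X} {h : ℝ → ℝ} {C : ℝ}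
    (hU : ∀ τ ∈ Icc a b, ∀ s ∈ Icc a b, ∀ t ∈ Icc a b, s ≤ t → ‖U τ t - U τ s‖ ≤ C * (h t - h s)) :
    ‖P.sum U‖ ≤ C * (h b - h a) := by
  calc ‖P.sum U‖ ≤ ∑ j ∈ Finset.range P.ν, C * (h (P.t (j + 1)) - h (P.t j)) := by
        refine norm_sum_le_of_le _ fun j hj => ?_
        have hj := Finset.mem_range.1 hj
        exact hU _ (P.τ_mem hj) _ (P.t_mem hj.le) _ (P.t_mem hj) (P.t_le_succ hj)
    _ = C * (h b - h a) := by
        rw [← Finset.mul_sum, Finset.sum_range_sub (fun j => h (P.t j)), P.t_last, P.t_zero]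

/-- An integral sum of `f(t)` cut off to the tags in a lower set telescopes. -/
theorem exists_sum_lowerSet {X : Type*} [AddCommGroup X] (P : TaggedPartition a b) {D : Set ℝ}
    (hD : IsLowerSet D) (f : ℝ → X) :
    ∃ m ≤ P.ν, P.sum (fun τ t => D.indicator (fun _ => f t) τ) = f (P.t m) - f a ∧
      (∀ j < m, P.τ j ∈ D) ∧ (m < P.ν → P.τ m ∉ D) := by
  classical
  -- The least such `m` is the first index with tag outside `D`, or `P.ν` if there is none.
  have hex : ∃ m, m < P.ν → P.τ m ∉ D := ⟨P.ν, fun h => absurd h (lt_irrefl _)⟩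
  set m := Nat.find hex with hm
  have hmν : m ≤ P.ν := Nat.find_min' hex fun h => absurd h (lt_irrefl _)
  have h1 : ∀ j < m, P.τ j ∈ D := fun j hj => by
    have := Nat.find_min hex hj
    push Not at this
    exact this.2
  have h2 : m < P.ν → P.τ m ∉ D := Nat.find_spec hex
  refine ⟨m, hmν, ?_, h1, h2⟩
  have h0 : f a = f (P.t 0) := congrArg f P.t_zero.symm
  rw [sum, ← Finset.sum_range_add_sum_Ico _ hmν, h0]
  rw [Finset.sum_eq_zero (s := Finset.Ico m P.ν), add_zero,
    ← Finset.sum_range_sub (fun j => f (P.t j))]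
  · refine Finset.sum_congr rfl fun j hj => ?_
    simp [h1 j (Finset.mem_range.1 hj)]
  · intro j hj
    obtain ⟨hj1, hj2⟩ := Finset.mem_Ico.1 hj
    have : P.τ j ∉ D := fun h => h2 (hj1.trans_lt hj2) (hD (P.τ_mono hj1 hj2) h)
    simp [this]

end TaggedPartition

/-! ### Regularity from monotone domination -/

section Regulated

variable {a b : ℝ} {X : Type*} [NormedAddCommGroup X]

/-- A function into a complete space whose increments are dominated by those of a monotone
function is regulated. -/
theorem isRegulated_of_dominated [CompleteSpace X] {f : Icc a b → X} {h : Icc a b → ℝ} {C : ℝ}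
    (hh : Monotone h) (hf : ∀ s t, ‖f t - f s‖ ≤ C * |h t - h s|) : IsRegulated f := by
  have key : ∀ (l : Filter (Icc a b)) (r : ℝ), Tendsto h l (𝓝 r) → ∃ y, Tendsto f l (𝓝 y) := by
    intro l r hr
    rcases l.eq_or_neBot with rfl | hl
    · exact ⟨0, tendsto_bot⟩
    · refine cauchy_map_iff_exists_tendsto.1 (Metric.cauchy_iff.2 ⟨inferInstance, fun ε hε => ?_⟩)
      -- `C` may be zero or negative; `|C| + 1` is a positive bound for it.
      have hC : 0 < |C| + 1 := by positivity
      obtain ⟨s, hs, hsε⟩ := (Metric.cauchy_iff.1 hr.cauchy_map).2 (ε / (|C| + 1)) (by positivity)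
      refine ⟨f '' (h ⁻¹' s), image_mem_map hs, ?_⟩
      rintro _ ⟨u, hu, rfl⟩ _ ⟨v, hv, rfl⟩
      have h1 := hsε _ hu _ hv
      rw [Real.dist_eq, lt_div_iff₀ hC] at h1
      rw [dist_eq_norm]
      refine (hf v u).trans_lt ?_
      nlinarith [abs_nonneg (h u - h v), le_abs_self C]
  exact fun t => ⟨key _ _ (hh.tendsto_nhdsLT t), key _ _ (hh.tendsto_nhdsGT t)⟩

end Regulated

/-! ### Uniqueness, linearity and existence of the Kurzweil integral -/

section Integral

open TaggedPartition

variable {a b : ℝ} {X : Type*} [NormedAddCommGroup X]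

/-- As a limit along a filter, the integral inherits linearity, uniqueness and the Cauchy criterion.
-/
theorem hasKurzweilIntegral_iff_tendsto {U : ℝ → ℝ → X} {I : X} :
    HasKurzweilIntegral U a b I ↔ Tendsto (fun P => P.sum U) (fineFilter a b) (𝓝 I) := by
  rw [((hasBasis_fineFilter a b).tendsto_iff Metric.nhds_basis_ball)]
  simp [HasKurzweilIntegral, dist_eq_norm]

namespace HasKurzweilIntegral

theorem unique (hab : a ≤ b) {U : ℝ → ℝ → X} {I J : X} (hI : HasKurzweilIntegral U a b I)
    (hJ : HasKurzweilIntegral U a b J) : I = J := by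
  have := fineFilter_neBot hab
  exact tendsto_nhds_unique (hasKurzweilIntegral_iff_tendsto.1 hI)
    (hasKurzweilIntegral_iff_tendsto.1 hJ)

theorem add {U V : ℝ → ℝ → X} {I J : X} (hI : HasKurzweilIntegral U a b I)
    (hJ : HasKurzweilIntegral V a b J) :
    HasKurzweilIntegral (fun τ t => U τ t + V τ t) a b (I + J) := by
  rw [hasKurzweilIntegral_iff_tendsto] at *
  simpa only [sum_add] using hI.add hJ

theorem sub {U V : ℝ → ℝ → X} {I J : X} (hI : HasKurzweilIntegral U a b I)
    (hJ : HasKurzweilIntegral V a b J) :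
    HasKurzweilIntegral (fun τ t => U τ t - V τ t) a b (I - J) := by
  rw [hasKurzweilIntegral_iff_tendsto] at *
  simpa only [sum_sub] using hI.sub hJ

theorem smul [NormedSpace ℝ X] {U : ℝ → ℝ → X} {I : X} (c : ℝ)
    (hI : HasKurzweilIntegral U a b I) :
    HasKurzweilIntegral (fun τ t => c • U τ t) a b (c • I) := by
  rw [hasKurzweilIntegral_iff_tendsto] at *
  simpa only [sum_smul] using hI.const_smul c

theorem finsetSum {ι : Type*} (s : Finset ι) {U : ι → ℝ → ℝ → X} {I : ι → X}
    (hI : ∀ i ∈ s, HasKurzweilIntegral (U i) a b (I i)) :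
    HasKurzweilIntegral (fun τ t => ∑ i ∈ s, U i τ t) a b (∑ i ∈ s, I i) := by
  simp only [hasKurzweilIntegral_iff_tendsto, sum_finsetSum] at *
  exact tendsto_finsetSum s hI

/-- The integral over an initial interval changes by at most the increment of a dominating
function. -/
theorem norm_sub_le {U : ℝ → ℝ → X} {h : ℝ → ℝ} {C : ℝ} {c : ℝ} {I J : X} (hab : a ≤ b)
    (hbc : b ≤ c) (hI : HasKurzweilIntegral U a b I) (hJ : HasKurzweilIntegral U a c J)
    (hU : ∀ τ ∈ Icc b c, ∀ s ∈ Icc b c, ∀ t ∈ Icc b c, s ≤ t →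
      ‖U τ t - U τ s‖ ≤ C * (h t - h s)) :
    ‖J - I‖ ≤ C * (h c - h b) := by
  refine le_of_forall_pos_le_add fun ε hε => ?_
  obtain ⟨δ, hδ, hδI⟩ := hI (ε / 2) (half_pos hε)
  obtain ⟨δ', hδ', hδJ⟩ := hJ (ε / 2) (half_pos hε)
  have hmin : ∀ τ, 0 < min (δ τ) (δ' τ) := fun τ => lt_min (hδ τ) (hδ' τ)
  -- The sum over the concatenation and the sum over `P` approximate the two integrals and differ
  -- exactly by the sum over `Q`.
  obtain ⟨P, hP⟩ := exists_isFine hmin hab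
  obtain ⟨Q, hQ⟩ := exists_isFine hmin hbc
  have h1 := hδI P (hP.mono fun τ => min_le_left _ _)
  have h2 := hδJ (P.append Q) ((hP.append hQ).mono fun τ => min_le_right _ _)
  have h3 := Q.norm_sum_le hU
  rw [sum_append] at h2
  have h4 : J - I = Q.sum U + (P.sum U - I) - (P.sum U + Q.sum U - J) := by abel
  rw [h4]
  refine (_root_.norm_sub_le _ _).trans ?_
  have := norm_add_le (Q.sum U) (P.sum U - I)
  linarith

end HasKurzweilIntegral

theorem hasKurzweilIntegral_self (U : ℝ → ℝ → X) : HasKurzweilIntegral U a a 0 := by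
  refine fun ε hε => ⟨fun _ => 1, fun _ => one_pos, fun P _ => ?_⟩
  have h0 : P.sum U = 0 := Finset.sum_eq_zero fun j hj => by
    have hj := Finset.mem_range.1 hj
    have h1 := P.t_mem hj.le
    have h2 := P.t_mem (Nat.succ_le_of_lt hj)
    rw [Icc_self, mem_singleton_iff] at h1 h2
    rw [h1, h2, sub_self]
  simpa [h0] using hε

/-- The integral of `f(t)` cut off in `τ` to a lower set exists for regulated `f`. -/
theorem exists_hasKurzweilIntegral_lowerSet {D : Set ℝ} (hD : IsLowerSet D)
    {f : ℝ → X} (hf : IsRegulated fun t : Icc a b => f t) :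
    ∃ I, HasKurzweilIntegral (fun τ t => D.indicator (fun _ => f t) τ) a b I := by
  by_cases hbD : b ∈ D
  · refine ⟨f b - f a, fun ε hε => ⟨fun _ => 1, fun _ => one_pos, fun P _ => ?_⟩⟩
    obtain ⟨m, hm, hsum, -, h2⟩ := P.exists_sum_lowerSet hD f
    have : m = P.ν := hm.eq_of_not_lt fun h => h2 h (hD (P.τ_mem h).2 hbD)
    rw [hsum, this, P.t_last, sub_self, norm_zero]
    exact hε
  by_cases haD : a ∉ D
  · refine ⟨0, fun ε hε => ⟨fun _ => 1, fun _ => one_pos, fun P _ => ?_⟩⟩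
    obtain ⟨m, hm, hsum, h1, -⟩ := P.exists_sum_lowerSet hD f
    have : m = 0 := by
      by_contra h0
      have h0 := Nat.pos_of_ne_zero h0
      exact haD (hD (P.τ_mem (h0.trans_le hm)).1 (h1 0 h0))
    rw [hsum, this, P.t_zero, sub_self, sub_zero, norm_zero]
    exact hε
  push Not at haD
  have hbub : ∀ x ∈ D, x < b := fun x hx => lt_of_not_ge fun h => hbD (hD h hx)
  have hbdd : BddAbove D := ⟨b, fun x hx => (hbub x hx).le⟩
  set c := sSup D with hc
  have hac : a ≤ c := le_csSup hbdd haD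
  have hcb : c ≤ b := csSup_le ⟨a, haD⟩ fun x hx => (hbub x hx).le
  have hltD : ∀ x < c, x ∈ D := fun x hx => by
    obtain ⟨y, hy, hxy⟩ := exists_lt_of_lt_csSup ⟨a, haD⟩ hx
    exact hD hxy.le hy
  have hDle : ∀ x ∈ D, x ≤ c := fun x hx => le_csSup hbdd hx
  -- A tag `τ ≠ c` has gauge `|τ - c|`, so its interval cannot contain `c`. Any interval containing
  -- `c` is thus tagged at `c` and lies within `d` of it.
  have gauge : ∀ {P : TaggedPartition a b} {d : ℝ} {j : ℕ},
      P.IsFine (fun τ => if τ = c then d else |τ - c|) → j < P.ν → P.t j ≤ c → c ≤ P.t (j + 1) →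
      P.τ j = c ∧ c - d < P.t j ∧ P.t (j + 1) < c + d := by
    intro P d j hP hj h1 h2
    have hτ : P.τ j = c := by
      by_contra hne
      have h3 := hP j hj ⟨h1, h2⟩
      simp only [if_neg hne, mem_Ioo] at h3
      rcases le_total (P.τ j) c with h | h
      · rw [abs_of_nonpos (by linarith)] at h3
        linarith [h3.2]
      · rw [abs_of_nonneg (by linarith)] at h3
        linarith [h3.1]
    have h4 := hP j hj ⟨le_rfl, P.t_le_succ hj⟩
    have h5 := hP j hj ⟨P.t_le_succ hj, le_rfl⟩
    simp only [hτ, if_true, mem_Ioo] at h4 h5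
    exact ⟨hτ, h4.1, h5.2⟩
  have gpos : ∀ {d : ℝ}, 0 < d → ∀ τ : ℝ, 0 < (if τ = c then d else |τ - c|) := by
    intro d hd τ
    split_ifs with h
    · exact hd
    · exact abs_pos.2 (sub_ne_zero.2 h)
  -- If `c ∈ D`, an interval tagged at `c` still counts, so the sum stops just to the right of `c`
  -- and the limit is `f(c+) - f(a)`. Otherwise it stops just to the left and the limit is `f(c-) -
  -- f(a)`.
  by_cases hcD : c ∈ D
  · obtain ⟨-, r, hr⟩ := hf ⟨c, hac, hcb⟩
    refine ⟨r - f a, fun ε hε => ?_⟩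
    obtain ⟨d, hd, hdr⟩ := Metric.mem_nhdsWithin_iff.1 (hr (Metric.ball_mem_nhds r hε))
    refine ⟨_, gpos hd, fun P hP => ?_⟩
    obtain ⟨m, hm, hsum, h1, h2⟩ := P.exists_sum_lowerSet hD f
    have hcm : c < P.t m := by
      rcases hm.eq_or_lt with rfl | h
      · rw [P.t_last]
        exact hbub c hcD
      · have hτ : c < P.τ m := lt_of_not_ge fun h' => h2 h (hD h' hcD)
        by_contra hle
        push Not at hle
        have := (gauge hP h hle (hτ.le.trans (P.tag_mem m h).2)).1
        exact hτ.ne' this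
    have hm0 : m ≠ 0 := by
      rintro rfl
      rw [P.t_zero] at hcm
      exact hcm.not_ge hac
    obtain ⟨k, rfl⟩ := Nat.exists_eq_succ_of_ne_zero hm0
    have hk := gauge hP (Nat.lt_of_succ_le hm)
      ((P.tag_mem k (Nat.lt_of_succ_le hm)).1.trans (hDle _ (h1 k (Nat.lt_succ_self k)))) hcm.le
    have hmem : (⟨P.t (k + 1), P.t_mem hm⟩ : Icc a b) ∈
        Metric.ball ⟨c, hac, hcb⟩ d ∩ Ioi ⟨c, hac, hcb⟩ := by
      refine ⟨?_, hcm⟩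
      rw [Metric.mem_ball, Subtype.dist_eq, Real.dist_eq, abs_of_pos (sub_pos.2 hcm)]
      linarith [hk.2.2]
    have := hdr hmem
    rw [hsum, sub_sub_sub_cancel_right]
    exact mem_ball_iff_norm.1 this
  · obtain ⟨⟨l, hl⟩, -⟩ := hf ⟨c, hac, hcb⟩
    refine ⟨l - f a, fun ε hε => ?_⟩
    obtain ⟨d, hd, hdl⟩ := Metric.mem_nhdsWithin_iff.1 (hl (Metric.ball_mem_nhds l hε))
    refine ⟨_, gpos hd, fun P hP => ?_⟩
    obtain ⟨m, hm, hsum, h1, h2⟩ := P.exists_sum_lowerSet hD f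
    have hDlt : ∀ x ∈ D, x < c := fun x hx => (hDle x hx).lt_of_ne fun h => hcD (h ▸ hx)
    have hmc : P.t m < c := by
      rcases Nat.eq_zero_or_pos m with rfl | h
      · rw [P.t_zero]
        exact hDlt a haD
      · obtain ⟨k, rfl⟩ := Nat.exists_eq_succ_of_ne_zero h.ne'
        have hτ := hDlt _ (h1 k (Nat.lt_succ_self k))
        have hk := Nat.lt_of_succ_le hm
        by_contra hle
        push Not at hle
        exact hτ.ne (gauge hP hk ((P.tag_mem k hk).1.trans hτ.le) hle).1
    have hmν : m < P.ν := hm.lt_of_ne fun h => by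
      rw [h, P.t_last] at hmc
      exact hmc.not_ge hcb
    have hcτ : c ≤ P.τ m := le_of_not_gt fun h => h2 hmν (hltD _ h)
    have hk := gauge hP hmν hmc.le (hcτ.trans (P.tag_mem m hmν).2)
    have hmem : (⟨P.t m, P.t_mem hm⟩ : Icc a b) ∈
        Metric.ball ⟨c, hac, hcb⟩ d ∩ Iio ⟨c, hac, hcb⟩ := by
      refine ⟨?_, hmc⟩
      rw [Metric.mem_ball, Subtype.dist_eq, Real.dist_eq, abs_of_neg (sub_neg.2 hmc)]
      linarith [hk.2.1]
    have := hdl hmem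
    rw [hsum, sub_sub_sub_cancel_right]
    exact mem_ball_iff_norm.1 this

/-- Kurzweil integrability is preserved under approximation in the sense of integral sums. -/
theorem exists_hasKurzweilIntegral_of_approx [CompleteSpace X] (hab : a ≤ b) {U : ℝ → ℝ → X}
    (hU : ∀ ε > 0, ∃ (V : ℝ → ℝ → X) (J : X), HasKurzweilIntegral V a b J ∧
      ∀ P : TaggedPartition a b, ‖P.sum U - P.sum V‖ ≤ ε) :
    ∃ I, HasKurzweilIntegral U a b I := by
  have := fineFilter_neBot hab
  simp only [hasKurzweilIntegral_iff_tendsto]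
  refine cauchy_map_iff_exists_tendsto.1 (Metric.cauchy_iff.2 ⟨inferInstance, fun ε hε => ?_⟩)
  obtain ⟨V, J, hV, hUV⟩ := hU (ε / 4) (by positivity)
  obtain ⟨δ, hδ, hδV⟩ := hV (ε / 4) (by positivity)
  refine ⟨(fun P : TaggedPartition a b => P.sum U) '' {P | P.IsFine δ},
    image_mem_map ((hasBasis_fineFilter a b).mem_of_mem (i := ⟨δ, hδ⟩) trivial), ?_⟩
  have key : ∀ P : TaggedPartition a b, P.IsFine δ → dist (P.sum U) J < ε / 2 := by
    intro P hP
    have h1 := hδV P hP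
    have h2 := hUV P
    rw [← dist_eq_norm] at h1 h2
    linarith [dist_triangle (P.sum U) (P.sum V) J]
  rintro _ ⟨P, hP, rfl⟩ _ ⟨Q, hQ, rfl⟩
  linarith [dist_triangle_right (P.sum U) (Q.sum U) J, key P hP, key Q hQ]

/-- Existence of the Kurzweil integral for integrands that vary little in `τ`, relative to a
monotone function of `t`, on the classes of finite interval partitions. -/
theorem exists_hasKurzweilIntegral [CompleteSpace X] (hab : a ≤ b) {U : ℝ → ℝ → X}
    {h : ℝ → ℝ} (hh : MonotoneOn h (Icc a b)) {C : ℝ}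
    (hU : ∀ τ ∈ Icc a b, ∀ s ∈ Icc a b, ∀ t ∈ Icc a b, ‖U τ t - U τ s‖ ≤ C * |h t - h s|)
    (hosc : ∀ ε > 0, ∃ (κ : ℝ → ℕ) (N : ℕ), Monotone κ ∧ (∀ u, κ u < N) ∧
      ∀ u ∈ Icc a b, ∀ v ∈ Icc a b, κ u = κ v → ∀ s ∈ Icc a b, ∀ t ∈ Icc a b,
        ‖U u t - U u s - (U v t - U v s)‖ ≤ ε * |h t - h s|) :
    ∃ I, HasKurzweilIntegral U a b I := by
  classical
  have hreg : ∀ τ ∈ Icc a b, IsRegulated fun t : Icc a b => U τ t := fun τ hτ =>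
    isRegulated_of_dominated (h := fun t : Icc a b => h t) (C := C)
      (fun s t hst => hh s.2 t.2 hst) fun s t => hU τ hτ s s.2 t t.2
  refine exists_hasKurzweilIntegral_of_approx hab fun ε hε => ?_
  have hpos : 0 < h b - h a + 1 := by
    linarith [hh (left_mem_Icc.2 hab) (right_mem_Icc.2 hab) hab]
  obtain ⟨κ, N, hκ, hN, hκU⟩ := hosc (ε / (h b - h a + 1)) (by positivity)
  -- A representative of each class; empty classes get `a`, so that `U (r k)` is regulated for every
  -- `k`.
  let r : ℕ → ℝ := fun k => if hk : ∃ u ∈ Icc a b, κ u = k then hk.choose else a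
  have hr : ∀ k, r k ∈ Icc a b := by
    intro k
    by_cases hk : ∃ u ∈ Icc a b, κ u = k
    · simpa only [r, dif_pos hk] using hk.choose_spec.1
    · simpa only [r, dif_neg hk] using left_mem_Icc.2 hab
  have hκr : ∀ u ∈ Icc a b, κ (r (κ u)) = κ u := by
    intro u hu
    have hk : ∃ v ∈ Icc a b, κ v = κ u := ⟨u, hu, rfl⟩
    simpa only [r, dif_pos hk] using hk.choose_spec.2
  have h1 : ∀ k, ∃ I, HasKurzweilIntegral
      (fun τ t => {u | κ u ≤ k}.indicator (fun _ => U (r k) t) τ) a b I := fun k =>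
    exists_hasKurzweilIntegral_lowerSet (fun u v hvu (hu : κ u ≤ k) => (hκ hvu).trans hu)
      (hreg _ (hr k))
  have h2 : ∀ k, ∃ I, HasKurzweilIntegral
      (fun τ t => {u | κ u < k}.indicator (fun _ => U (r k) t) τ) a b I := fun k =>
    exists_hasKurzweilIntegral_lowerSet (fun u v hvu (hu : κ u < k) => (hκ hvu).trans_lt hu)
      (hreg _ (hr k))
  choose I hI using h1
  choose J hJ using h2
  refine ⟨_, _, HasKurzweilIntegral.finsetSum (Finset.range N) fun k _ => (hI k).sub (hJ k), ?_⟩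
  intro P
  -- Each class is a difference of two lower sets, and only `k = κ τ` contributes at `τ`.
  have hV : (fun τ t => ∑ k ∈ Finset.range N, ({u | κ u ≤ k}.indicator (fun _ => U (r k) t) τ -
      {u | κ u < k}.indicator (fun _ => U (r k) t) τ)) = fun τ t => U (r (κ τ)) t := by
    funext τ t
    rw [Finset.sum_eq_single_of_mem (κ τ) (Finset.mem_range.2 (hN τ))]
    · simp
    · intro k _ hk
      rcases lt_or_gt_of_ne hk with h | h
      · simp [h.not_ge, h.le]
      · simp [h, h.le]
  rw [hV, ← P.sum_sub]
  refine (P.norm_sum_le (h := h) (C := ε / (h b - h a + 1)) ?_).trans ?_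
  · intro τ hτ s hs t ht hst
    have := hκU τ hτ _ (hr _) (hκr τ hτ).symm s hs t ht
    rw [abs_of_nonneg (sub_nonneg.2 (hh hs ht hst))] at this
    convert this using 2
    abel
  · rw [div_mul_eq_mul_div, div_le_iff₀ hpos]
    nlinarith

end Integral

/-! ### Regulated functions are nearly constant on finitely many intervals -/

section Regulated

variable {a b : ℝ} {X : Type*} [NormedAddCommGroup X]

/-- A regulated function is nearly constant on the classes of a finite interval partition. -/
theorem IsRegulated.exists_finite_partition {x : Icc a b → X} (hx : IsRegulated x) {ε : ℝ}
    (hε : 0 < ε) : ∃ (κ : ℝ → ℕ) (N : ℕ), Monotone κ ∧ (∀ u, κ u < N) ∧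
      ∀ u v : Icc a b, κ u = κ v → ‖x u - x v‖ < ε := by
  classical
  have hloc : ∀ t : Icc a b, ∃ d : ℝ, 0 < d ∧ ∀ u v : Icc a b,
      (((t : ℝ) - d < u ∧ (u : ℝ) < t ∧ (t : ℝ) - d < v ∧ (v : ℝ) < t) ∨
        ((t : ℝ) < u ∧ (u : ℝ) < t + d ∧ (t : ℝ) < v ∧ (v : ℝ) < t + d)) → ‖x u - x v‖ < ε := by
    intro t
    obtain ⟨⟨l, hl⟩, ⟨r, hr⟩⟩ := hx t
    obtain ⟨d₁, hd₁, h₁⟩ := Metric.mem_nhdsWithin_iff.1 (hl (Metric.ball_mem_nhds l (half_pos hε)))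
    obtain ⟨d₂, hd₂, h₂⟩ := Metric.mem_nhdsWithin_iff.1 (hr (Metric.ball_mem_nhds r (half_pos hε)))
    have e₁ : ∀ u : Icc a b, t - d₁ < u → u < (t : ℝ) → dist (x u) l < ε / 2 := by
      intro u hu hut
      refine h₁ ⟨?_, hut⟩
      rw [Metric.mem_ball, Subtype.dist_eq, Real.dist_eq, abs_of_neg (sub_neg.2 hut)]
      linarith
    have e₂ : ∀ u : Icc a b, (t : ℝ) < u → u < t + d₂ → dist (x u) r < ε / 2 := by
      intro u hut hu
      refine h₂ ⟨?_, hut⟩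
      rw [Metric.mem_ball, Subtype.dist_eq, Real.dist_eq, abs_of_pos (sub_pos.2 hut)]
      linarith
    refine ⟨min d₁ d₂, lt_min hd₁ hd₂, fun u v huv => ?_⟩
    have m₁ := min_le_left d₁ d₂
    have m₂ := min_le_right d₁ d₂
    rw [← dist_eq_norm]
    rcases huv with ⟨hu, hu', hv, hv'⟩ | ⟨hu, hu', hv, hv'⟩
    · linarith [dist_triangle_right (x u) (x v) l, e₁ u (by linarith) hu', e₁ v (by linarith) hv']
    · linarith [dist_triangle_right (x u) (x v) r, e₂ u hu (by linarith), e₂ v hv (by linarith)]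
  choose d hd hdx using hloc
  obtain ⟨S, -, hS⟩ := (isCompact_univ (X := Icc a b)).elim_nhds_subcover
    (fun t => Metric.ball t (d t)) fun t _ => Metric.ball_mem_nhds t (hd t)
  -- Centres and ends of a finite cover: if no point of `E` lies in `[u, v]`, then `u` and `v` lie
  -- on the same side of the centre in one ball.
  let E : Finset ℝ := S.biUnion fun t => {(t : ℝ), t - d t, t + d t}
  have hE : ∀ u v : Icc a b, u ≤ v → (∀ e ∈ E, ¬ ((u : ℝ) ≤ e ∧ e ≤ v)) → ‖x u - x v‖ < ε := by
    intro u v huv hne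
    obtain ⟨t, htS, hut⟩ := mem_iUnion₂.1 (hS (mem_univ u))
    rw [Metric.mem_ball, Subtype.dist_eq, Real.dist_eq, abs_lt] at hut
    have huv' : (u : ℝ) ≤ v := huv
    have h1 := hne t (Finset.mem_biUnion.2 ⟨t, htS, by simp⟩)
    have h2 := hne (t + d t) (Finset.mem_biUnion.2 ⟨t, htS, by simp⟩)
    have hv : (v : ℝ) < t + d t := by
      by_contra hv
      exact h2 ⟨by linarith, by linarith⟩
    refine hdx t u v ?_
    rcases lt_or_ge (t : ℝ) u with h | h
    · exact Or.inr ⟨h, by linarith, by linarith, hv⟩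
    · have hvt : (v : ℝ) < t := by
        by_contra hv
        exact h1 ⟨h, by linarith⟩
      exact Or.inl ⟨by linarith, by linarith, by linarith, hvt⟩
  -- Counting with both `≤` and `<` makes each point of `E` a class of its own.
  refine ⟨fun u => (E.filter (· ≤ u)).card + (E.filter (· < u)).card, E.card + E.card + 1,
    fun u v huv => ?_, fun u => ?_, ?_⟩
  · exact add_le_add
      (Finset.card_le_card (Finset.monotone_filter_right _ fun e _ he => le_trans he huv))
      (Finset.card_le_card (Finset.monotone_filter_right _ fun e _ he => lt_of_lt_of_le he huv))
  · exact Nat.lt_succ_of_le (add_le_add (Finset.card_filter_le _ _) (Finset.card_filter_le _ _))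
  · have key : ∀ u v : Icc a b, u < v → (E.filter (· ≤ (u : ℝ))).card + (E.filter (· < (u : ℝ))).card
        = (E.filter (· ≤ (v : ℝ))).card + (E.filter (· < (v : ℝ))).card → ‖x u - x v‖ < ε := by
      intro u v huv heq
      have huv' : (u : ℝ) < v := huv
      have s₁ : E.filter (· ≤ (u : ℝ)) ⊆ E.filter (· ≤ (v : ℝ)) :=
        Finset.monotone_filter_right _ fun e _ he => le_trans he huv'.le
      have s₂ : E.filter (· < (u : ℝ)) ⊆ E.filter (· < (v : ℝ)) :=
        Finset.monotone_filter_right _ fun e _ he => lt_trans he huv'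
      have c₁ := Finset.card_le_card s₁
      have c₂ := Finset.card_le_card s₂
      have q₁ := Finset.eq_of_subset_of_card_le s₁ (by omega)
      have q₂ := Finset.eq_of_subset_of_card_le s₂ (by omega)
      refine hE u v huv.le fun e he heuv => ?_
      have m₁ : e ∈ E.filter (· ≤ (u : ℝ)) := q₁ ▸ Finset.mem_filter.2 ⟨he, heuv.2⟩
      have heu : e = u := le_antisymm (Finset.mem_filter.1 m₁).2 heuv.1
      have m₂ : e ∈ E.filter (· < (u : ℝ)) := q₂ ▸ Finset.mem_filter.2 ⟨he, heu ▸ huv'⟩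
      exact (Finset.mem_filter.1 m₂).2.ne heu
    intro u v huv
    rcases lt_trichotomy u v with h | h | h
    · exact key u v h huv
    · rw [h, sub_self, norm_zero]
      exact hε
    · rw [norm_sub_rev]
      exact key v u h huv.symm

theorem IsRegulated.prodMk {Y : Type*} [NormedAddCommGroup Y] {x : Icc a b → X} {y : Icc a b → Y}
    (hx : IsRegulated x) (hy : IsRegulated y) : IsRegulated fun t => (x t, y t) := by
  intro t
  obtain ⟨⟨l, hl⟩, ⟨r, hr⟩⟩ := hx t
  obtain ⟨⟨l', hl'⟩, ⟨r', hr'⟩⟩ := hy t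
  exact ⟨⟨(l, l'), hl.prodMk_nhds hl'⟩, ⟨(r, r'), hr.prodMk_nhds hr'⟩⟩

end Regulated

/-! ### The Banach space of regulated functions and its totally bounded sets -/

namespace RegulatedSpace

variable {a b : ℝ} {X : Type*} [NormedAddCommGroup X] [NormedSpace ℝ X]

theorem eval_of_mem (x : RegulatedSpace a b X) {t : ℝ} (ht : t ∈ Icc a b) :
    x.eval t = (x : lp (fun _ : Icc a b => X) ∞) ⟨t, ht⟩ := dif_pos ht

theorem eval_mk {x : Icc a b → X} (hx : IsRegulated x) {t : ℝ} (ht : t ∈ Icc a b) :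
    (mk x hx).eval t = x ⟨t, ht⟩ := dif_pos ht

theorem isRegulated_eval (x : RegulatedSpace a b X) : IsRegulated fun t : Icc a b => x.eval t := by
  have h : (fun t : Icc a b => x.eval t) = fun t => (x : lp (fun _ : Icc a b => X) ∞) t :=
    funext fun t => x.eval_of_mem t.2
  rw [h]
  exact x.2

theorem ext_eval {x y : RegulatedSpace a b X} (h : ∀ t ∈ Icc a b, x.eval t = y.eval t) :
    x = y := by
  refine Subtype.ext (lp.ext (funext fun t => ?_))
  rw [← x.eval_of_mem t.2, ← y.eval_of_mem t.2, h t t.2]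

theorem eval_add (x y : RegulatedSpace a b X) (t : ℝ) : (x + y).eval t = x.eval t + y.eval t := by
  by_cases ht : t ∈ Icc a b
  · simp only [eval_of_mem _ ht]
    rfl
  · simp [eval, ht]

theorem eval_smul (c : ℝ) (x : RegulatedSpace a b X) (t : ℝ) : (c • x).eval t = c • x.eval t := by
  by_cases ht : t ∈ Icc a b
  · simp only [eval_of_mem _ ht]
    rfl
  · simp [eval, ht]

theorem eval_sub (x y : RegulatedSpace a b X) (t : ℝ) : (x - y).eval t = x.eval t - y.eval t := by
  rw [sub_eq_add_neg, ← neg_one_smul ℝ y, eval_add, eval_smul, neg_one_smul, sub_eq_add_neg]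

theorem norm_eval_le (x : RegulatedSpace a b X) (t : ℝ) : ‖x.eval t‖ ≤ ‖x‖ := by
  by_cases ht : t ∈ Icc a b
  · rw [eval_of_mem _ ht]
    exact lp.norm_apply_le_norm ENNReal.top_ne_zero _ _
  · simp [eval, ht]

theorem norm_le {x : RegulatedSpace a b X} {C : ℝ} (hC : 0 ≤ C)
    (h : ∀ t ∈ Icc a b, ‖x.eval t‖ ≤ C) : ‖x‖ ≤ C :=
  lp.norm_le_of_forall_le hC fun t => (x.eval_of_mem t.2) ▸ h t t.2

/-- A uniform limit keeps the Cauchy property along each one-sided filter, by an `ε / 3` argument.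
The resulting completeness serves both the compactness of `K` and the Fredholm alternative. -/
theorem isClosed_regulatedSubmodule [CompleteSpace X] :
    IsClosed (regulatedSubmodule a b X : Set (lp (fun _ : Icc a b => X) ∞)) := by
  refine isClosed_of_closure_subset fun x hx => ?_
  have key : ∀ l : Filter (Icc a b), (∀ y : RegulatedSpace a b X, ∃ c,
      Tendsto (fun t => (y : lp (fun _ : Icc a b => X) ∞) t) l (𝓝 c)) →
      ∃ c, Tendsto (fun t => x t) l (𝓝 c) := by
    intro l hl
    rcases l.eq_or_neBot with rfl | hne
    · exact ⟨0, tendsto_bot⟩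
    refine cauchy_map_iff_exists_tendsto.1 (Metric.cauchy_iff.2 ⟨inferInstance, fun ε hε => ?_⟩)
    obtain ⟨y, hy, hxy⟩ := Metric.mem_closure_iff.1 hx (ε / 3) (by positivity)
    obtain ⟨c, hc⟩ := hl ⟨y, hy⟩
    obtain ⟨s, hs, hsε⟩ := (Metric.cauchy_iff.1 hc.cauchy_map).2 (ε / 3) (by positivity)
    refine ⟨_, image_mem_map hs, ?_⟩
    have hd : ∀ t, dist (x t) (y t) < ε / 3 := fun t => by
      rw [dist_eq_norm] at hxy ⊢
      exact (lp.norm_apply_le_norm ENNReal.top_ne_zero (x - y) t).trans_lt hxy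
    rintro _ ⟨u, hu, rfl⟩ _ ⟨v, hv, rfl⟩
    have h1 : dist (y u) (y v) < ε / 3 := hsε _ hu _ hv
    linarith [dist_triangle4_right (x u) (x v) (y u) (y v), hd u, hd v]
  exact fun t => ⟨key _ fun y => (y.2 t).1, key _ fun y => (y.2 t).2⟩

instance [CompleteSpace X] : CompleteSpace (RegulatedSpace a b X) :=
  isClosed_regulatedSubmodule.completeSpace_coe

/-- A bounded set of functions whose increments are dominated by those of one monotone function is
totally bounded in the supremum norm. -/
theorem totallyBounded_of_dominated [ProperSpace X] {B : Set (RegulatedSpace a b X)} {h : ℝ → ℝ}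
    (hh : MonotoneOn h (Icc a b)) {M C : ℝ} (hM : ∀ x ∈ B, ‖x‖ ≤ M)
    (hB : ∀ x ∈ B, ∀ s ∈ Icc a b, ∀ t ∈ Icc a b, ‖x.eval t - x.eval s‖ ≤ C * |h t - h s|) :
    TotallyBounded B := by
  refine Metric.totallyBounded_of_finite_discretization fun ε hε => ?_
  have hC : 0 < |C| + 1 := by positivity
  -- Bands of `h` of height `η` leave each function an oscillation below `ε / 8`. Two oscillations
  -- and two code errors then add up to at most `ε / 2`.
  set η := ε / 8 / (|C| + 1) with hη
  have hηpos : 0 < η := by positivity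
  let κ : ℝ → ℕ := fun u => ⌊(h u - h a) / η⌋₊
  let N := ⌊(h b - h a) / η⌋₊ + 1
  have hκN : ∀ u ∈ Icc a b, κ u < N := by
    intro u hu
    refine Nat.lt_succ_of_le (Nat.floor_mono ?_)
    gcongr
    exact hh hu (right_mem_Icc.2 (hu.1.trans hu.2)) hu.2
  have hκ : ∀ u ∈ Icc a b, ∀ v ∈ Icc a b, κ u = κ v → C * |h u - h v| < ε / 8 := by
    intro u hu v hv huv
    have h0 : ∀ w ∈ Icc a b, 0 ≤ (h w - h a) / η := fun w hw =>
      div_nonneg (sub_nonneg.2 (hh (left_mem_Icc.2 (hw.1.trans hw.2)) hw hw.1)) hηpos.le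
    have hlt := Int.abs_sub_lt_one_of_floor_eq_floor
      (a := (h u - h a) / η) (b := (h v - h a) / η) (by
        rw [← Int.natCast_floor_eq_floor (h0 u hu), ← Int.natCast_floor_eq_floor (h0 v hv)]
        exact congrArg _ huv)
    rw [← sub_div, sub_sub_sub_cancel_right, abs_div, abs_of_pos hηpos, div_lt_one hηpos, hη,
      lt_div_iff₀ hC] at hlt
    nlinarith [abs_nonneg (h u - h v), le_abs_self C]
  classical
  let r : Fin N → ℝ := fun k => if hk : ∃ u ∈ Icc a b, κ u = k then hk.choose else a
  have hr : ∀ u (hu : u ∈ Icc a b), r ⟨κ u, hκN u hu⟩ ∈ Icc a b ∧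
      κ (r ⟨κ u, hκN u hu⟩) = κ u := by
    intro u hu
    have hk : ∃ v ∈ Icc a b, κ v = κ u := ⟨u, hu, rfl⟩
    simpa only [r, dif_pos hk] using hk.choose_spec
  have htb : TotallyBounded (Metric.closedBall (0 : Fin N → X) |M|) :=
    (isCompact_closedBall _ _).totallyBounded
  obtain ⟨S, hSfin, hS⟩ := Metric.totallyBounded_iff.1 htb (ε / 8) (by positivity)
  -- The vector of samples lies in a compact ball of `Fin N → X`; a point of its finite net encodes
  -- `x`.
  have hcode : ∀ x : B, ∃ y : S, dist (fun k => (x : RegulatedSpace a b X).eval (r k)) y.1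
      < ε / 8 := by
    intro x
    have hx : (fun k => (x : RegulatedSpace a b X).eval (r k)) ∈
        Metric.closedBall (0 : Fin N → X) |M| := by
      rw [mem_closedBall_zero_iff, pi_norm_le_iff_of_nonneg (abs_nonneg M)]
      exact fun k => (norm_eval_le _ _).trans ((hM x x.2).trans (le_abs_self M))
    obtain ⟨y, hy, hxy⟩ := mem_iUnion₂.1 (hS hx)
    exact ⟨⟨y, hy⟩, hxy⟩
  choose c hc using hcode
  refine ⟨S, hSfin.fintype, c, fun x y hxy => ?_⟩
  rw [dist_eq_norm]
  refine (norm_le (half_pos hε).le fun t ht => ?_).trans_lt (half_lt_self hε)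
  rw [eval_sub]
  obtain ⟨hrt, hκt⟩ := hr t ht
  set k : Fin N := ⟨κ t, hκN t ht⟩
  have e1 := (hB x x.2 _ hrt t ht).trans_lt (hκ t ht _ hrt hκt.symm)
  have e2 := (hB y y.2 _ hrt t ht).trans_lt (hκ t ht _ hrt hκt.symm)
  have e3 := (dist_le_pi_dist _ _ k).trans_lt (hc x)
  have e4 := (dist_le_pi_dist _ _ k).trans_lt (hc y)
  rw [← hxy] at e4
  rw [← dist_eq_norm] at e1 e2 ⊢
  have := dist_triangle4 ((x : RegulatedSpace a b X).eval t)
    ((x : RegulatedSpace a b X).eval (r k)) ((y : RegulatedSpace a b X).eval (r k))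
    ((y : RegulatedSpace a b X).eval t)
  rw [dist_comm ((y : RegulatedSpace a b X).eval (r k))] at this
  have := dist_triangle_right ((x : RegulatedSpace a b X).eval (r k))
    ((y : RegulatedSpace a b X).eval (r k)) ((c x).1 k)
  linarith

end RegulatedSpace

/-! ### The integral operator and the Fredholm alternative -/

section Operator

variable {a b : ℝ} {X Z : Type*} [NormedAddCommGroup X] [NormedSpace ℝ X] [NormedAddCommGroup Z]

/-- Existence of `∫_a^s D[A(τ, t) z(τ)]` for regulated `z`. -/
theorem exists_hasKurzweilIntegral_apply [CompleteSpace X] {A : ℝ → ℝ → (X →L[ℝ] X)}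
    {h : ℝ → ℝ} (hh : MonotoneOn h (Icc a b))
    (hA : ∀ τ ∈ Icc a b, ∀ s ∈ Icc a b, ∀ t ∈ Icc a b, ‖A τ t - A τ s‖ ≤ |h t - h s|)
    {x : ℝ → Z} (hx : IsRegulated fun t : Icc a b => x t)
    (hAx : ∀ ε > 0, ∃ η > 0, ∀ u ∈ Icc a b, ∀ v ∈ Icc a b, ‖x u - x v‖ < η →
      ∀ s ∈ Icc a b, ∀ t ∈ Icc a b, ‖A u t - A u s - A v t + A v s‖ ≤ ε * |h t - h s|)
    (z : RegulatedSpace a b X) {s : ℝ} (hs : s ∈ Icc a b) :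
    ∃ I, HasKurzweilIntegral (fun τ t => A τ t (z.eval τ)) a s I := by
  have hsub : Icc a s ⊆ Icc a b := Icc_subset_Icc_right hs.2
  refine exists_hasKurzweilIntegral hs.1 (hh.mono hsub) (C := ‖z‖) ?_ ?_
  · intro τ hτ u hu v hv
    rw [← sub_apply, mul_comm]
    exact ((A τ v - A τ u).le_opNorm _).trans (mul_le_mul
      (hA τ (hsub hτ) u (hsub hu) v (hsub hv)) (z.norm_eval_le τ) (norm_nonneg _) (abs_nonneg _))
  · intro ε hε
    have hz : 0 < ‖z‖ + 1 := by positivity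
    obtain ⟨η, hη, hAη⟩ := hAx (ε / (2 * (‖z‖ + 1))) (by positivity)
    -- Using the pair `(x, z)` gives one partition on whose classes both functions vary little.
    obtain ⟨κ, N, hκ, hN, hκη⟩ := (hx.prodMk z.isRegulated_eval).exists_finite_partition
      (lt_min hη (half_pos hε))
    refine ⟨κ, N, hκ, hN, fun u hu v hv huv p hp t ht => ?_⟩
    have hd := hκη ⟨u, hsub hu⟩ ⟨v, hsub hv⟩ huv
    rw [Prod.mk_sub_mk, Prod.norm_mk, max_lt_iff] at hd
    have hd1 := hd.1.trans_le (min_le_left _ _)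
    have hd2 := hd.2.trans_le (min_le_right _ _)
    have h1 := hAη u (hsub hu) v (hsub hv) hd1 p (hsub hp) t (hsub ht)
    have h2 := hA v (hsub hv) p (hsub hp) t (hsub ht)
    -- Product rule: the change of the operator increment and the change of `z` each cost at most `ε
    -- / 2` times the increment of `h`.
    have h3 : A u t (z.eval u) - A u p (z.eval u) - (A v t (z.eval v) - A v p (z.eval v)) =
        (A u t - A u p - A v t + A v p) (z.eval u) + (A v t - A v p) (z.eval u - z.eval v) := by
      simp only [sub_apply, add_apply, map_sub]
      abel
    rw [h3]
    calc _ ≤ ε / (2 * (‖z‖ + 1)) * |h t - h p| * (‖z‖ + 1) + |h t - h p| * (ε / 2) := by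
          refine norm_add_le_of_le ?_ ?_
          · exact (ContinuousLinearMap.le_opNorm _ _).trans (mul_le_mul h1
              ((z.norm_eval_le u).trans (by linarith)) (norm_nonneg _) (by positivity))
          · exact (ContinuousLinearMap.le_opNorm _ _).trans (mul_le_mul h2 hd2.le
              (norm_nonneg _) (abs_nonneg _))
      _ = ε * |h t - h p| := by
          field_simp
          ring

/-- The operator `z ↦ z(b) + ∫_a^· D[A(τ, t) z(τ)]` is compact. -/
theorem exists_isCompactOperator_kurzweil [ProperSpace X] (hab : a ≤ b)
    {A : ℝ → ℝ → (X →L[ℝ] X)} {h : ℝ → ℝ} (hh : MonotoneOn h (Icc a b))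
    (hA : ∀ τ ∈ Icc a b, ∀ s ∈ Icc a b, ∀ t ∈ Icc a b, ‖A τ t - A τ s‖ ≤ |h t - h s|)
    {x : ℝ → Z} (hx : IsRegulated fun t : Icc a b => x t)
    (hAx : ∀ ε > 0, ∃ η > 0, ∀ u ∈ Icc a b, ∀ v ∈ Icc a b, ‖x u - x v‖ < η →
      ∀ s ∈ Icc a b, ∀ t ∈ Icc a b, ‖A u t - A u s - A v t + A v s‖ ≤ ε * |h t - h s|) :
    ∃ K : RegulatedSpace a b X →L[ℝ] RegulatedSpace a b X, IsCompactOperator K ∧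
      ∀ z : RegulatedSpace a b X, ∀ s ∈ Icc a b,
        HasKurzweilIntegral (fun τ t => A τ t (z.eval τ)) a s ((K z).eval s - z.eval b) := by
  have hex : ∀ (z : RegulatedSpace a b X) (s : Icc a b),
      ∃ I, HasKurzweilIntegral (fun τ t => A τ t (z.eval τ)) a s I := fun z s =>
    exists_hasKurzweilIntegral_apply hh hA hx hAx z s.2
  choose I hI using hex
  have hmono : Monotone fun t : Icc a b => h t := fun s t hst => hh s.2 t.2 hst
  have hle : ∀ z (s t : Icc a b), s ≤ t → ‖I z t - I z s‖ ≤ ‖z‖ * (h t - h s) := by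
    intro z s t hst
    refine (hI z s).norm_sub_le s.2.1 hst (hI z t) fun τ hτ u hu v hv huv => ?_
    have hsub : Icc (s : ℝ) t ⊆ Icc a b := Icc_subset_Icc s.2.1 t.2.2
    have h1 := hA τ (hsub hτ) u (hsub hu) v (hsub hv)
    rw [abs_of_nonneg (sub_nonneg.2 (hh (hsub hu) (hsub hv) huv))] at h1
    rw [← sub_apply, mul_comm]
    exact ((A τ v - A τ u).le_opNorm _).trans (mul_le_mul h1 (z.norm_eval_le τ) (norm_nonneg _)
      ((norm_nonneg _).trans h1))
  have hdom : ∀ z (s t : Icc a b), ‖I z t - I z s‖ ≤ ‖z‖ * |h t - h s| := by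
    intro z s t
    rcases le_total s t with hst | hst
    · exact (hle z s t hst).trans (mul_le_mul_of_nonneg_left (le_abs_self _) (norm_nonneg z))
    · rw [norm_sub_rev, abs_sub_comm]
      exact (hle z t s hst).trans (mul_le_mul_of_nonneg_left (le_abs_self _) (norm_nonneg z))
  have hKdom : ∀ z (s t : Icc a b),
      ‖z.eval b + I z t - (z.eval b + I z s)‖ ≤ ‖z‖ * |h t - h s| := fun z s t => by
    rw [add_sub_add_left_eq_sub]
    exact hdom z s t
  have hreg : ∀ z, IsRegulated fun t : Icc a b => z.eval b + I z t := fun z =>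
    isRegulated_of_dominated hmono (hKdom z)
  have hIa : ∀ z, I z ⟨a, left_mem_Icc.2 hab⟩ = 0 := fun z =>
    (hI z ⟨a, left_mem_Icc.2 hab⟩).unique le_rfl (hasKurzweilIntegral_self _)
  let G : RegulatedSpace a b X → RegulatedSpace a b X := fun z => .mk _ (hreg z)
  have hG : ∀ z t (ht : t ∈ Icc a b), (G z).eval t = z.eval b + I z ⟨t, ht⟩ := fun z t ht =>
    RegulatedSpace.eval_mk (hreg z) ht
  let L : RegulatedSpace a b X →ₗ[ℝ] RegulatedSpace a b X :=
    { toFun := G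
      map_add' := fun y z => RegulatedSpace.ext_eval fun t ht => by
        have h1 : I (y + z) ⟨t, ht⟩ = I y ⟨t, ht⟩ + I z ⟨t, ht⟩ := by
          refine (hI (y + z) ⟨t, ht⟩).unique ht.1 ?_
          simpa only [RegulatedSpace.eval_add, map_add] using (hI y ⟨t, ht⟩).add (hI z ⟨t, ht⟩)
        rw [RegulatedSpace.eval_add, hG _ t ht, hG _ t ht, hG _ t ht, RegulatedSpace.eval_add, h1]
        abel
      map_smul' := fun c z => RegulatedSpace.ext_eval fun t ht => by
        have h1 : I (c • z) ⟨t, ht⟩ = c • I z ⟨t, ht⟩ := by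
          refine (hI (c • z) ⟨t, ht⟩).unique ht.1 ?_
          simpa only [RegulatedSpace.eval_smul, map_smul] using (hI z ⟨t, ht⟩).smul c
        rw [RingHom.id_apply, RegulatedSpace.eval_smul, hG _ t ht, hG _ t ht,
          RegulatedSpace.eval_smul, h1, smul_add] }
  have hL : ∀ z t (ht : t ∈ Icc a b), (L z).eval t = z.eval b + I z ⟨t, ht⟩ := hG
  have hvar : 0 ≤ h b - h a :=
    sub_nonneg.2 (hh (left_mem_Icc.2 hab) (right_mem_Icc.2 hab) hab)
  have hbound : ∀ z, ‖L z‖ ≤ (1 + (h b - h a)) * ‖z‖ := by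
    intro z
    refine RegulatedSpace.norm_le (by positivity) fun t ht => ?_
    rw [hL z t ht]
    have h1 := hle z ⟨a, left_mem_Icc.2 hab⟩ ⟨t, ht⟩ ht.1
    rw [hIa, sub_zero] at h1
    have h2 : h t ≤ h b := hh ht (right_mem_Icc.2 hab) ht.2
    have h3 := norm_add_le (z.eval b) (I z ⟨t, ht⟩)
    have h4 := z.norm_eval_le b
    have h5 : ‖z‖ * (h t - h a) ≤ ‖z‖ * (h b - h a) := by gcongr
    dsimp only at h1
    linarith
  let K := L.mkContinuous _ hbound
  have hK : ∀ z t (ht : t ∈ Icc a b), (K z).eval t = z.eval b + I z ⟨t, ht⟩ := hL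
  refine ⟨K, ?_, fun z s hs => ?_⟩
  · refine (isCompactOperator_iff_isCompact_closure_image_closedBall
      (K : RegulatedSpace a b X →ₗ[ℝ] RegulatedSpace a b X) one_pos).2 ?_
    refine TotallyBounded.isCompact_of_isClosed (TotallyBounded.closure ?_) isClosed_closure
    -- Both constants come from `‖z‖ ≤ 1` in `hbound` and `hKdom`.
    refine RegulatedSpace.totallyBounded_of_dominated hh (M := 1 + (h b - h a)) (C := 1) ?_ ?_
    · rintro _ ⟨z, hz, rfl⟩
      rw [mem_closedBall_zero_iff] at hz
      exact (hbound z).trans (mul_le_of_le_one_right (by positivity) hz)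
    · rintro _ ⟨z, hz, rfl⟩ s hs t ht
      rw [mem_closedBall_zero_iff] at hz
      have h1 := hKdom z ⟨s, hs⟩ ⟨t, ht⟩
      rw [← hK z s hs, ← hK z t ht] at h1
      exact h1.trans (mul_le_mul_of_nonneg_right hz (abs_nonneg _))
  · rw [hK z s hs, add_sub_cancel_left]
    exact hI z ⟨s, hs⟩

/-- Fredholm alternative for the equation `z - K z = q`. -/
theorem IsCompactOperator.xor_existsUnique_sub_eq {E : Type*} [NormedAddCommGroup E]
    [NormedSpace ℝ E] [CompleteSpace E] {K : E →L[ℝ] E} (hK : IsCompactOperator K) :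
    Xor (∀ q, ∃! z, z - K z = q) (∃ z, z ≠ 0 ∧ z - K z = 0) := by
  by_cases hker : ∃ z, z ≠ 0 ∧ z - K z = 0
  · refine Or.inr ⟨hker, fun hq => ?_⟩
    obtain ⟨z, hz, hKz⟩ := hker
    exact hz ((hq 0).unique hKz (by simp))
  · refine Or.inl ⟨?_, hker⟩
    -- An eigenvector for `1` would solve the homogeneous equation; otherwise `1 - K` is bijective.
    rcases hK.hasEigenvalue_or_mem_resolventSet one_ne_zero with h | h
    · obtain ⟨z, hz⟩ := h.exists_hasEigenvector
      refine absurd ⟨z, hz.2, ?_⟩ hker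
      have : K z = z := by simpa using hz.apply_eq_smul
      rw [this, sub_self]
    · rw [spectrum.mem_resolventSet_iff, ContinuousLinearMap.isUnit_iff_bijective] at h
      intro q
      simpa [Algebra.algebraMap_eq_smul_one] using h.existsUnique q

end Operator

/-! ### The linearized periodic problem -/

theorem mainTheorem7 {n : ℕ} {T : ℝ} (hT : 0 < T)
    (Λ : Set ℝ) (hΛ : IsOpen Λ) (Ω : Set (RVec n)) (hΩ : IsOpen Ω)
    (F : ℝ → RVec n → ℝ → RVec n)
    (hF : ∃ h ω : ℝ → ℝ, ∀ lam ∈ Λ, KurzweilClass Ω 0 T h ω (F lam))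
    (x₀ : RegulatedSpace 0 T (RVec n))
    (hx₀ : ∀ lam ∈ Λ, IsPeriodicSolution Ω (F lam) x₀)
    (hρ : ∃ ρ > 0, ∀ x ∈ Metric.closedBall x₀ ρ, ∀ t ∈ Set.Icc 0 T, x.eval t ∈ Ω)
    (F' : ℝ → RVec n → ℝ → (RVec n →L[ℝ] RVec n))
    (hF' : ∀ lam ∈ Λ, ∀ x ∈ Ω, ∀ t ∈ Set.Icc 0 T,
      HasFDerivAt (fun y => F lam y t) (F' lam x t) x)
    (hF'cont : ∀ lam ∈ Λ, ∀ t ∈ Set.Icc 0 T, ContinuousOn (fun x => F' lam x t) Ω)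
    (hF'class : ∃ h ω : ℝ → ℝ, ∀ lam ∈ Λ, KurzweilClass Ω 0 T h ω (F' lam))
    (lam₀ : ℝ) (hlam₀ : lam₀ ∈ Λ) :
    Xor (∀ q : RegulatedSpace 0 T (RVec n), ∃! z : RegulatedSpace 0 T (RVec n),
        SolvesLinearized (F' lam₀) x₀ z q)
      (∃ z : RegulatedSpace 0 T (RVec n), z ≠ 0 ∧ SolvesLinearized (F' lam₀) x₀ z 0) ∧
    ∃ K : RegulatedSpace 0 T (RVec n) →L[ℝ] RegulatedSpace 0 T (RVec n),
      IsCompactOperator K ∧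
      ∀ z : RegulatedSpace 0 T (RVec n), ∀ s ∈ Set.Icc 0 T,
        HasKurzweilIntegral (fun τ t => F' lam₀ (x₀.eval τ) t (z.eval τ)) 0 s
          ((K z).eval s - z.eval T) := by
  obtain ⟨h, ω, hclass⟩ := hF'class
  have hc := hclass lam₀ hlam₀
  have hxΩ : ∀ s ∈ Icc 0 T, x₀.eval s ∈ Ω := fun s hs => ((hx₀ lam₀ hlam₀).1 s hs).1
  obtain ⟨K, hK, hKint⟩ := exists_isCompactOperator_kurzweil (X := RVec n) hT.le
    (A := fun τ t => F' lam₀ (x₀.eval τ) t) hc.h_mono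
    (fun τ hτ s hs t ht => hc.bound _ (hxΩ τ hτ) s hs t ht) x₀.isRegulated_eval (by
      intro ε hε
      -- Continuity of `ω` at `0` with `ω 0 = 0` turns the modulus bound into the required `ε`-`η`
      -- condition.
      have h0 := Metric.continuousWithinAt_iff.1 (hc.ω_cont 0 self_mem_Ici) ε hε
      obtain ⟨η, hη, hωη⟩ := h0
      refine ⟨η, hη, fun u hu v hv huv s hs t ht => ?_⟩
      refine (hc.bound_diff _ (hxΩ u hu) _ (hxΩ v hv) s hs t ht).trans
        (mul_le_mul_of_nonneg_right ?_ (abs_nonneg _))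
      have h1 := hωη (norm_nonneg (x₀.eval u - x₀.eval v)) (by simpa using huv)
      rw [hc.ω_zero, Real.dist_0_eq_abs] at h1
      exact (le_abs_self _).trans h1.le)
  -- Uniqueness of the integral identifies the witness `J` with the value given by `K`.
  have hiff : ∀ z q : RegulatedSpace 0 T (RVec n),
      SolvesLinearized (F' lam₀) x₀ z q ↔ z - K z = q := by
    intro z q
    constructor
    · intro hz
      refine RegulatedSpace.ext_eval fun s hs => ?_
      obtain ⟨J, hJ, hJq⟩ := hz s hs
      rw [← hJq, hJ.unique hs.1 (hKint z s hs), RegulatedSpace.eval_sub]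
      abel
    · rintro rfl s hs
      refine ⟨_, hKint z s hs, ?_⟩
      rw [RegulatedSpace.eval_sub]
      abel
  refine ⟨?_, K, hK, hKint⟩
  simp only [hiff]
  exact hK.xor_existsUnique_sub_eq
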